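/- Let $L>1$ be an odd integer. For $n\ge 1$ let $\Omega=\{0,1,\dots,n-1\}^2$, let $\Omega_1=(L\Omega)\cap\Omega$ be the set of points of $\Omega$ with both coordinates divisible by $L$, and for $y\in\Omega_1$ let $B_1(y)=\{x\in\Omega : y_\mu\le x_\mu<y_\mu+L,\ \mu=0,1\}$; for $x\in\Omega$ let $y_x\in\Omega_1$ be the unique label with $x\in B_1(y_x)$. Let $\Omega'$ be the set of bonds $b=(b_-,b_+)$ with $b_\pm\in\Omega$, $b_+=b_-+e_\mu$. The spaces of $\mathbb{R}^3$-valued functions carry the scalar products $\langle f,g\rangle_\Omega=\sum_{x\in\Omega} f(x)\cdot g(x)$, $\langle f,g\rangle_{\Omega_1}=L^2\sum_{y\in\Omega_1} f(y)\cdot g(y)$, $\langle f,g\rangle_{\Omega'}=\sum_{b\in\Omega'} f(b)\cdot g(b)$, and adjoints refer to these. Let $(\partial f)(b)=f(b_-)-f(b_+)$, $\Delta_\Omega=-\partial^*\partial$ (the Neumann Laplacian), $(Qf)(y)=L^{-2}\sum_{x\in B_1(y)}f(x)$, so that $(Q^*f)(x)=f(y_x)$, and $G(\Omega)=(-\Delta_\Omega+Q^*Q)^{-1}$.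 For $\vec A:\Omega\to\mathbb{R}^3$ with $\|\vec A\|_{\infty;\Omega}:=\sup_{x\in\Omega}|\vec A(x)|\le 1$ ($|\cdot|$ the Euclidean norm) let $$(R_{\vec A}\vec v)(x)=\sqrt{1-|\vec A(x)|^2}\,\vec v(x)+\vec A(x)\times\vec v(x),\qquad (R^*_{\vec A}\vec v)(x)=\sqrt{1-|\vec A(x)|^2}\,\vec v(x)-\vec A(x)\times\vec v(x),$$ and let $D_{\vec A}=Q\,G(\Omega)\,R^*_{\vec A}\,Q^*$, an operator on $\mathcal L^2(\Omega_1;\mathbb{R}^3)$. Write $\|\cdot\|_{\infty,\infty;\Omega}$ and $\|\cdot\|_{\infty,\infty;\Omega_1}$ for the operator norms with respect to the sup norms (of the Euclidean length) on $\mathbb{R}^3$-valued functions on $\Omega$ and $\Omega_1$. Then there are $\varepsilon_0\in(0,1]$ and $C>0$, depending only on $L$, such that for all $n\ge1$ and all $0<\varepsilon\le\varepsilon_0$: 1. For every $\vec A:\Omega\to\mathbb{R}^3$ with $\sup_{x\in\Omega}|\vec A(x)|\le\varepsilon$, the operator $D_{\vec A}$ is invertible on $\mathcal L^2(\Omega_1;\mathbb{R}^3)$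 and $\|D_{\vec A}^{-1}\|_{\infty,\infty;\Omega_1}\le C$. 2. For all $\vec A_1,\vec A_2:\Omega\to\mathbb{R}^3$ with $\sup_{x\in\Omega}|\vec A_i(x)|\le\varepsilon$, $i=1,2$, $$\|D_{\vec A_1}^{-1}-D_{\vec A_2}^{-1}\|_{\infty,\infty;\Omega_1}\le 2\,\|G(\Omega)\|_{\infty,\infty;\Omega}\,\|D_{\vec A_1}^{-1}\|_{\infty,\infty;\Omega_1}\,\|D_{\vec A_2}^{-1}\|_{\infty,\infty;\Omega_1}\,\|\vec A_1-\vec A_2\|_{\infty;\Omega},$$ and moreover $\|D_{\vec A_1}^{-1}-D_{\vec A_2}^{-1}\|_{\infty,\infty;\Omega_1}\le C\,\|\vec A_1-\vec A_2\|_{\infty;\Omega}$. -/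

import Mathlib

noncomputable section

namespace NLSM

/-- Euclidean space `ℝ³`. -/
abbrev R3 : Type := EuclideanSpace ℝ (Fin 3)

/-- The fine lattice `Ω = {0, …, n-1}²`. -/
abbrev Site (n : ℕ) : Type := Fin 2 → Fin n

/-- The coarse lattice `Ω₁ = (L Ω) ∩ Ω`: the sites whose coordinates are multiples of `L`. -/
abbrev CoarseSite (L n : ℕ) : Type := {y : Site n // ∀ μ, L ∣ (y μ : ℕ)}

/-- The bonds `Ω'`: pairs `b = (b₋, b₊)` of sites with `b₊ = b₋ + e_μ` for a direction `μ`. -/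
abbrev Bond (n : ℕ) : Type :=
  {b : Site n × Site n // ∃ μ, (b.2 μ : ℕ) = (b.1 μ : ℕ) + 1 ∧ ∀ ν, ν ≠ μ → b.2 ν = b.1 ν}

/-- `ℝ³`-valued functions on `Ω`. Its norm is the sup norm `‖f‖ = sup_x |f x|`, so that the norm of
`Field n →L[ℝ] Field n` is the operator norm `‖·‖_{∞,∞;Ω}`. -/
abbrev Field (n : ℕ) : Type := Site n → R3

/-- `ℝ³`-valued functions on `Ω₁`, with the sup norm; the norm of
`CoarseField L n →L[ℝ] CoarseField L n` is the operator norm `‖·‖_{∞,∞;Ω₁}`. -/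
abbrev CoarseField (L n : ℕ) : Type := CoarseSite L n → R3

/-- `ℝ³`-valued functions on the bonds. -/
abbrev BondField (n : ℕ) : Type := Bond n → R3

/-- The scalar product of `𝓛²(Ω; ℝ³)`. -/
def ip {n : ℕ} (f g : Field n) : ℝ := ∑ x, inner ℝ (f x) (g x)

/-- The scalar product of `𝓛²(Ω₁; ℝ³)`, with weight `L²`. -/
def coarseIp {L n : ℕ} (f g : CoarseField L n) : ℝ := (L : ℝ) ^ 2 * ∑ y, inner ℝ (f y) (g y)

/-- The scalar product of `𝓛²(Ω'; ℝ³)`. -/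
def bondIp {n : ℕ} (f g : BondField n) : ℝ := ∑ b, inner ℝ (f b) (g b)

/-- The box `B₁(y) = {x ∈ Ω | y_μ ≤ x_μ < y_μ + L, μ = 0, 1}`. -/
def box {L n : ℕ} (y : CoarseSite L n) : Finset (Site n) :=
  {x : Site n | ∀ μ, (y.1 μ : ℕ) ≤ x μ ∧ (x μ : ℕ) < y.1 μ + L}

/-- The label `y_x` of the box containing `x`. -/
def label (L : ℕ) {n : ℕ} (x : Site n) : CoarseSite L n :=
  ⟨fun μ => ⟨L * ((x μ : ℕ) / L), (Nat.mul_div_le _ _).trans_lt (x μ).2⟩,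
    fun _ => Dvd.intro _ rfl⟩

theorem mem_box_iff {L n : ℕ} (hL : 0 < L) (x : Site n) (y : CoarseSite L n) :
    x ∈ box y ↔ label L x = y := by
  simp only [box, Finset.mem_filter, Finset.mem_univ, true_and]
  constructor
  · intro h
    apply Subtype.ext
    funext μ
    apply Fin.ext
    obtain ⟨k, hk⟩ := y.2 μ
    obtain ⟨h1, h2⟩ := h μ
    have : (x μ : ℕ) / L = k := by
      rw [Nat.div_eq_iff hL]
      rw [hk] at h1 h2
      constructor
      · rw [mul_comm]; exact h1
      · rw [mul_comm k L]; omega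
    simp [label, this, hk]
  · rintro rfl μ
    have := Nat.div_add_mod (x μ : ℕ) L
    have := Nat.mod_lt (x μ : ℕ) hL
    simp only [label]
    constructor <;> omega

/-- The averaging operator `(Q f)(y) = L⁻² ∑_{x ∈ B₁(y)} f(x)`. -/
def Q (L n : ℕ) : Field n →L[ℝ] CoarseField L n :=
  LinearMap.toContinuousLinearMap
    { toFun := fun f y => ((L : ℝ) ^ 2)⁻¹ • ∑ x ∈ box y, f x
      map_add' := by
        intro f g
        funext y
        simp [Finset.sum_add_distrib]
      map_smul' := by
        intro c f
        funext y
        simp only [Pi.smul_apply, ← Finset.smul_sum, RingHom.id_apply]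
        rw [smul_comm] }

/-- The adjoint of `Q`: `(Q* f)(x) = f(y_x)`. -/
def Qstar (L n : ℕ) : CoarseField L n →L[ℝ] Field n :=
  LinearMap.toContinuousLinearMap
    { toFun := fun f x => f (label L x)
      map_add' := fun _ _ => rfl
      map_smul' := fun _ _ => rfl }

theorem Q_apply (L n : ℕ) (f : Field n) (y : CoarseSite L n) :
    Q L n f y = ((L : ℝ) ^ 2)⁻¹ • ∑ x ∈ box y, f x := rfl

theorem Qstar_apply (L n : ℕ) (f : CoarseField L n) (x : Site n) :
    Qstar L n f x = f (label L x) := rfl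

theorem Q_adjoint {L n : ℕ} (hL : 0 < L) (f : Field n) (g : CoarseField L n) :
    coarseIp (Q L n f) g = ip f (Qstar L n g) := by
  classical
  have hL' : (L : ℝ) ^ 2 ≠ 0 := by positivity
  simp only [coarseIp, ip, Q_apply, Qstar_apply, inner_smul_left, sum_inner]
  simp only [conj_trivial]
  rw [← Finset.mul_sum, ← mul_assoc, mul_inv_cancel₀ hL', one_mul]
  have hb : ∀ y : CoarseSite L n, box y = Finset.univ.filter (fun x => label L x = y) := by
    intro y
    ext x
    simp [mem_box_iff hL]
  have : ∀ y : CoarseSite L n, ∑ x ∈ box y, inner ℝ (f x) (g y)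
      = ∑ x, if label L x = y then inner ℝ (f x) (g y) else 0 := by
    intro y
    rw [hb, Finset.sum_filter]
  simp only [this]
  rw [Finset.sum_comm]
  simp

/-- The lattice derivative `(∂ f)(b) = f(b₋) - f(b₊)`. -/
def del (n : ℕ) : Field n →L[ℝ] BondField n :=
  LinearMap.toContinuousLinearMap
    { toFun := fun f b => f b.1.1 - f b.1.2
      map_add' := by
        intro f g
        funext b
        simp only [Pi.add_apply]
        abel
      map_smul' := by
        intro c f
        funext b
        simp [smul_sub] }

/-- The adjoint of `∂`. -/
def delStar (n : ℕ) : BondField n →L[ℝ] Field n :=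
  LinearMap.toContinuousLinearMap
    { toFun := fun g x =>
        ∑ b : Bond n, ((if b.1.1 = x then g b else 0) - (if b.1.2 = x then g b else 0))
      map_add' := by
        intro f g
        funext x
        simp only [Pi.add_apply, ← Finset.sum_add_distrib]
        refine Finset.sum_congr rfl fun b _ => ?_
        split_ifs <;> (simp; try abel)
      map_smul' := by
        intro c f
        funext x
        simp only [Pi.smul_apply, RingHom.id_apply, Finset.smul_sum]
        refine Finset.sum_congr rfl fun b _ => ?_
        split_ifs <;> simp }

theorem del_apply (n : ℕ) (f : Field n) (b : Bond n) : del n f b = f b.1.1 - f b.1.2 := rfl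

theorem del_adjoint {n : ℕ} (f : Field n) (g : BondField n) :
    bondIp (del n f) g = ip f (delStar n g) := by
  classical
  have h : ∀ x, delStar n g x =
      ∑ b : Bond n, ((if b.1.1 = x then g b else 0) - (if b.1.2 = x then g b else 0)) := by
    intro x
    simp only [delStar, LinearMap.coe_toContinuousLinearMap', LinearMap.coe_mk, AddHom.coe_mk]
  simp only [bondIp, ip, del_apply, h, inner_sum]
  rw [Finset.sum_comm]
  refine Finset.sum_congr rfl fun b _ => ?_
  simp only [inner_sub_right, inner_sub_left, Finset.sum_sub_distrib, apply_ite (inner ℝ (f _)),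
    inner_zero_right, Finset.sum_ite_eq, Finset.mem_univ, if_true]

/-- The lattice Laplacian with Neumann boundary conditions, `Δ_Ω = -∂*∂`. -/
def laplacian (n : ℕ) : Field n →L[ℝ] Field n := -(delStar n ∘L del n)

/-- The operator `-Δ_Ω + Q*Q` on `𝓛²(Ω; ℝ³)`. -/
def K (L n : ℕ) : Field n →L[ℝ] Field n := -laplacian n + Qstar L n ∘L Q L n

/-- The Green function `G(Ω) = (-Δ_Ω + Q*Q)⁻¹`; the inverse exists by `isUnit_K`. -/
def G (L n : ℕ) : Field n →L[ℝ] Field n := Ring.inverse (K L n)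

theorem ip_K {L n : ℕ} (hL : 0 < L) (f : Field n) :
    ip f (K L n f) = bondIp (del n f) (del n f) + coarseIp (Q L n f) (Q L n f) := by
  rw [del_adjoint, Q_adjoint hL]
  simp [ip, K, laplacian, inner_add_right, Finset.sum_add_distrib]

theorem eq_of_del_eq_zero {n : ℕ} (f : Field n) (h : del n f = 0) (x x' : Site n) :
    f x = f x' := by
  have step : ∀ b : Bond n, f b.1.1 = f b.1.2 := fun b => sub_eq_zero.1 (congrFun h b)
  have hn : 0 < n := (Nat.zero_le _).trans_lt (x 0).2
  have key : ∀ (k : ℕ) (x : Site n), ∑ μ, (x μ : ℕ) = k → f x = f (fun _ => ⟨0, hn⟩) := by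
    intro k
    induction k with
    | zero =>
      intro x hx
      congr 1
      funext μ
      apply Fin.ext
      simpa using (Finset.sum_eq_zero_iff.1 hx) μ (Finset.mem_univ _)
    | succ k ih =>
      intro x hx
      obtain ⟨μ, hμ⟩ : ∃ μ, 0 < (x μ : ℕ) := by
        by_contra! hc
        have : ∑ μ, (x μ : ℕ) = 0 := Finset.sum_eq_zero fun μ _ => Nat.le_zero.1 (hc μ)
        omega
      let x' : Site n := Function.update x μ ⟨(x μ : ℕ) - 1, by have := (x μ).2; omega⟩
      have hx' : ((x' μ : Fin n) : ℕ) = (x μ : ℕ) - 1 := by simp [x']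
      have hν : ∀ ν, ν ≠ μ → x' ν = x ν := fun ν h => by simp [x', h]
      have hb := step ⟨(x', x), μ, by simp only [hx']; omega, fun ν h => (hν ν h).symm⟩
      rw [← hb]
      apply ih
      have e1 : (x μ : ℕ) + ∑ ν ∈ Finset.univ.erase μ, (x ν : ℕ) = ∑ ν, (x ν : ℕ) :=
        Finset.add_sum_erase Finset.univ (fun ν => (x ν : ℕ)) (Finset.mem_univ μ)
      have e2 : (x' μ : ℕ) + ∑ ν ∈ Finset.univ.erase μ, (x' ν : ℕ) = ∑ ν, (x' ν : ℕ) :=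
        Finset.add_sum_erase Finset.univ (fun ν => (x' ν : ℕ)) (Finset.mem_univ μ)
      have e3 : ∑ ν ∈ Finset.univ.erase μ, (x' ν : ℕ) = ∑ ν ∈ Finset.univ.erase μ, (x ν : ℕ) :=
        Finset.sum_congr rfl fun ν h => by rw [hν ν (Finset.ne_of_mem_erase h)]
      change ∑ ν, (x' ν : ℕ) = k
      omega
  rw [key _ x rfl, key _ x' rfl]

theorem isUnit_K {L : ℕ} (hL : 0 < L) (n : ℕ) : IsUnit (K L n) := by
  have hinj : Function.Injective (K L n) := by
    rw [injective_iff_map_eq_zero]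
    intro f hf
    have h0 := ip_K hL f
    have h1 : ip f (K L n f) = 0 := by simp [hf, ip]
    have h2 : 0 ≤ bondIp (del n f) (del n f) :=
      Finset.sum_nonneg fun b _ => real_inner_self_nonneg
    have h3 : 0 ≤ ∑ y, inner ℝ (Q L n f y) (Q L n f y) :=
      Finset.sum_nonneg fun b _ => real_inner_self_nonneg
    have hL2 : (0 : ℝ) < (L : ℝ) ^ 2 := by positivity
    have h4 : 0 ≤ coarseIp (Q L n f) (Q L n f) := mul_nonneg hL2.le h3
    have hd : del n f = 0 := by
      have : bondIp (del n f) (del n f) = 0 := by linarith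
      funext b
      exact inner_self_eq_zero.1 ((Finset.sum_eq_zero_iff_of_nonneg
        fun b _ => real_inner_self_nonneg).1 this b (Finset.mem_univ _))
    have hq : Q L n f = 0 := by
      have : (L : ℝ) ^ 2 * ∑ y, inner ℝ (Q L n f y) (Q L n f y) = 0 := by
        change coarseIp (Q L n f) (Q L n f) = 0
        linarith
      have := (mul_eq_zero.1 this).resolve_left hL2.ne'
      funext b
      exact inner_self_eq_zero.1 ((Finset.sum_eq_zero_iff_of_nonneg
        fun b _ => real_inner_self_nonneg).1 this b (Finset.mem_univ _))
    funext x
    have hs := congrFun hq (label L x)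
    rw [Q_apply, Finset.sum_congr rfl fun x' _ => eq_of_del_eq_zero f hd x' x,
      Finset.sum_const, Pi.zero_apply, smul_eq_zero] at hs
    have hs := hs.resolve_left (inv_ne_zero hL2.ne')
    rw [← Nat.cast_smul_eq_nsmul ℝ, smul_eq_zero, Nat.cast_eq_zero, Finset.card_eq_zero] at hs
    refine hs.resolve_left fun he => ?_
    have := (mem_box_iff hL x (label L x)).2 rfl
    simp [he] at this
  rw [ContinuousLinearMap.isUnit_iff_bijective]
  exact ⟨hinj, (LinearMap.injective_iff_surjective (f := (K L n).toLinearMap)).1 hinj⟩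

/-- The cross product on `ℝ³`. -/
def cross (a v : R3) : R3 := WithLp.toLp 2 (crossProduct (WithLp.ofLp a) (WithLp.ofLp v))

/-- `A₀ = √(1 - |A|²)`. -/
def scalarPart (a : R3) : ℝ := Real.sqrt (1 - ‖a‖ ^ 2)

/-- `(R_A v)(x) = A₀(x) v(x) + A(x) × v(x)` (with sign `s = 1`). -/
def R {n : ℕ} (A : Field n) : Field n →L[ℝ] Field n :=
  LinearMap.toContinuousLinearMap
    { toFun := fun v x => scalarPart (A x) • v x + cross (A x) (v x)
      map_add' := by
        intro f g
        funext x
        simp only [Pi.add_apply, smul_add, cross, WithLp.ofLp_add, map_add, WithLp.toLp_add]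
        abel
      map_smul' := by
        intro c f
        funext x
        simp only [Pi.smul_apply, cross, WithLp.ofLp_smul, map_smul, WithLp.toLp_smul,
          RingHom.id_apply, smul_add]
        rw [smul_comm] }

/-- The adjoint of `R_A`: `(R_A* v)(x) = A₀(x) v(x) - A(x) × v(x)`. -/
def Rstar {n : ℕ} (A : Field n) : Field n →L[ℝ] Field n :=
  LinearMap.toContinuousLinearMap
    { toFun := fun v x => scalarPart (A x) • v x - cross (A x) (v x)
      map_add' := by
        intro f g
        funext x
        simp only [Pi.add_apply, smul_add, cross, WithLp.ofLp_add, map_add, WithLp.toLp_add]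
        abel
      map_smul' := by
        intro c f
        funext x
        simp only [Pi.smul_apply, cross, WithLp.ofLp_smul, map_smul, WithLp.toLp_smul,
          RingHom.id_apply, smul_sub]
        rw [smul_comm] }

theorem R_adjoint {n : ℕ} (A f g : Field n) : ip (R A f) g = ip f (Rstar A g) := by
  refine Finset.sum_congr rfl fun x _ => ?_
  change inner ℝ (scalarPart (A x) • f x + cross (A x) (f x)) (g x)
    = inner ℝ (f x) (scalarPart (A x) • g x - cross (A x) (g x))
  simp only [PiLp.inner_apply, Fin.sum_univ_three, cross, cross_apply, RCLike.inner_apply,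
    conj_trivial, PiLp.add_apply, PiLp.sub_apply, PiLp.smul_apply, smul_eq_mul]
  simp
  ring

/-- The set of vector configurations with `sup_x |A(x)| ≤ ε`. -/
def vecConf (n : ℕ) (ε : ℝ) : Set (Field n) := {A | ∀ x, ‖A x‖ ≤ ε}

/-- `D_A = Q G(Ω) R_A* Q*` on `𝓛²(Ω₁; ℝ³)`. -/
def D (L : ℕ) {n : ℕ} (A : Field n) : CoarseField L n →L[ℝ] CoarseField L n :=
  Q L n ∘L G L n ∘L Rstar A ∘L Qstar L n

end NLSM

end

noncomputable section

namespace NLSM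

/-! Everything reduces to two bounds uniform in `n`: a sup-norm bound on `G` and a sup-norm lower
bound on `Q G Q*`, which is `D` at `A = 0`.

Both come from a weighted energy estimate. A Poincaré inequality in each box makes `K = -Δ + Q*Q`
coercive in L². If a weight `W` is constant on boxes and changes by a factor at most `1 + η` across
bonds, `weighted_coercive` keeps coercivity in the weighted norm up to an error `η²`. With `W`
decaying exponentially away from the box of a point `x₀`, the sum of `W` is bounded independently of
`n`, so the weighted L² bound controls `|f x₀|` by the sup of the source (`exists_sup_bound`). This
bounds `G`.

For `Q G Q*`, put `u = G Q* f` and `g = Q u`, so that `-Δu = Q*(f - g)`. Subtracting from `u` an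
explicit extension of `g` leaves a function with zero averages, against which sources in the range
of `Q*` are invisible; the same sup bound gives `‖u‖ ≤ const ‖g‖`. As `Δ` is bounded, `f = g + (f -
g)` is controlled by `g` (`exists_norm_le_QGQstar`).

Finally `A ↦ D_A` is Lipschitz with constant `2‖G‖` on `|A| ≤ 1/2`, so the lower bound survives for
small `A`, and the resolvent identity gives the second assertion. -/

theorem ip_K_bilin {L n : ℕ} (hL : 0 < L) (g f : Field n) :
    ip g (K L n f) = bondIp (del n g) (del n f) + coarseIp (Q L n g) (Q L n f) := by
  rw [del_adjoint, Q_adjoint hL]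
  simp [ip, K, laplacian, inner_add_right, Finset.sum_add_distrib]

/-! ### Box-constant weights, box geometry and the Poincaré inequality -/

/-- Multiplication by a weight that is constant on the boxes. -/
def weightMul {L n : ℕ} (W : CoarseSite L n → ℝ) (f : Field n) : Field n :=
  fun x => W (label L x) • f x

/-- Averaging commutes with box-constant weights. Hence `Q*Q` produces no commutator error, and
functions with zero averages keep them after weighting. -/
theorem Q_weightMul {L n : ℕ} (hL : 0 < L) (W : CoarseSite L n → ℝ) (f : Field n)
    (y : CoarseSite L n) : Q L n (weightMul W f) y = W y • Q L n f y := by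
  rw [Q_apply, Q_apply, smul_comm]
  congr 1
  rw [Finset.smul_sum]
  refine Finset.sum_congr rfl fun x hx => ?_
  rw [weightMul, (mem_box_iff hL x y).1 hx]

theorem coarse_mem_box {L n : ℕ} (hL : 0 < L) (y : CoarseSite L n) : y.1 ∈ box y := by
  simp only [box, Finset.mem_filter, Finset.mem_univ, true_and]
  intro μ
  omega

theorem card_box_pos {L n : ℕ} (hL : 0 < L) (y : CoarseSite L n) : 1 ≤ (box y).card :=
  Finset.card_pos.2 ⟨_, coarse_mem_box hL y⟩

/-- Only an inequality holds in general: `n` need not be a multiple of `L`, so boxes at the upper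
boundary may be truncated. -/
theorem card_box_le {L n : ℕ} (y : CoarseSite L n) : (box y).card ≤ L ^ 2 := by
  have h : (box y).card ≤ (Fintype.piFinset fun _ : Fin 2 => Finset.range L).card := by
    refine Finset.card_le_card_of_injOn (fun x μ => (x μ : ℕ) - y.1 μ) ?_ ?_
    · intro x hx
      simp only [box, Finset.coe_filter, Finset.mem_univ, true_and, Set.mem_ofPred_eq] at hx
      simp only [Finset.mem_coe, Fintype.mem_piFinset, Finset.mem_range]
      intro μ
      have := hx μ
      omega
    · intro x hx x' hx' he
      simp only [box, Finset.coe_filter, Finset.mem_univ, true_and, Set.mem_ofPred_eq] at hx hx'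
      funext μ
      have h1 := hx μ
      have h2 := hx' μ
      have h3 := congrFun he μ
      simp only at h3
      apply Fin.ext
      omega
  simpa using h

theorem sum_box {L n : ℕ} (hL : 0 < L) (F : Site n → ℝ) :
    ∑ y : CoarseSite L n, ∑ x ∈ box y, F x = ∑ x, F x := by
  classical
  have hb : ∀ y : CoarseSite L n, box y = Finset.univ.filter (fun x => label L x = y) := by
    intro y
    ext x
    simp [mem_box_iff hL]
  simp only [hb]
  exact Finset.sum_fiberwise _ _ _

/-- The Dirichlet energy of the bonds inside the box `B₁(y)`. -/
def boxEnergy {L n : ℕ} (f : Field n) (y : CoarseSite L n) : ℝ :=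
  ∑ b : Bond n, if label L b.1.1 = y ∧ label L b.1.2 = y then ‖del n f b‖ ^ 2 else 0

theorem boxEnergy_nonneg {L n : ℕ} (f : Field n) (y : CoarseSite L n) : 0 ≤ boxEnergy f y :=
  Finset.sum_nonneg fun b _ => by split_ifs <;> positivity

theorem norm_del_le {L n : ℕ} (f : Field n) (y : CoarseSite L n) (b : Bond n)
    (h1 : label L b.1.1 = y) (h2 : label L b.1.2 = y) :
    ‖del n f b‖ ≤ Real.sqrt (boxEnergy f y) := by
  apply Real.le_sqrt_of_sq_le
  have := Finset.single_le_sum (s := Finset.univ) (f := fun b : Bond n =>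
    if label L b.1.1 = y ∧ label L b.1.2 = y then ‖del n f b‖ ^ 2 else 0)
    (fun b _ => by split_ifs <;> positivity) (Finset.mem_univ b)
  simp only [h1, h2, and_self, if_true] at this
  exact this

/-- Lowering one coordinate at a time gives a path from `x` to the lowest corner that stays in the
box; each of its `k` bonds costs at most the square root of the box energy. -/
theorem norm_sub_corner_le_aux {L n : ℕ} (hL : 0 < L) (f : Field n) (y : CoarseSite L n) (k : ℕ) :
    ∀ x ∈ box y, ∑ μ, ((x μ : ℕ) - (y.1 μ : ℕ)) = k →
      ‖f x - f y.1‖ ≤ k * Real.sqrt (boxEnergy f y) := by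
  induction k with
  | zero =>
    intro x hx hk
    have : x = y.1 := by
      funext μ
      have h1 := (Finset.sum_eq_zero_iff.1 hk) μ (Finset.mem_univ _)
      simp only [box, Finset.mem_filter, Finset.mem_univ, true_and] at hx
      have := hx μ
      apply Fin.ext
      omega
    simp [this]
  | succ k ih =>
    intro x hx hk
    obtain ⟨μ, hμ⟩ : ∃ μ, 0 < (x μ : ℕ) - (y.1 μ : ℕ) := by
      by_contra! hc
      have : ∑ μ, ((x μ : ℕ) - (y.1 μ : ℕ)) = 0 :=
        Finset.sum_eq_zero fun μ _ => Nat.le_zero.1 (hc μ)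
      omega
    let x' : Site n := Function.update x μ ⟨(x μ : ℕ) - 1, by have := (x μ).2; omega⟩
    have hx' : ((x' μ : Fin n) : ℕ) = (x μ : ℕ) - 1 := by simp [x']
    have hν : ∀ ν, ν ≠ μ → x' ν = x ν := fun ν h => by simp [x', h]
    have hxb := hx
    simp only [box, Finset.mem_filter, Finset.mem_univ, true_and] at hxb
    have hx'b : x' ∈ box y := by
      simp only [box, Finset.mem_filter, Finset.mem_univ, true_and]
      intro ν
      by_cases h : ν = μ
      · subst h
        have := hxb ν
        omega
      · rw [hν ν h]
        exact hxb ν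
    have hsum : ∑ ν, ((x' ν : ℕ) - (y.1 ν : ℕ)) = k := by
      have e1 := Finset.add_sum_erase Finset.univ (fun ν => (x ν : ℕ) - (y.1 ν : ℕ))
        (Finset.mem_univ μ)
      have e2 := Finset.add_sum_erase Finset.univ (fun ν => (x' ν : ℕ) - (y.1 ν : ℕ))
        (Finset.mem_univ μ)
      have e3 : ∑ ν ∈ Finset.univ.erase μ, ((x' ν : ℕ) - (y.1 ν : ℕ))
          = ∑ ν ∈ Finset.univ.erase μ, ((x ν : ℕ) - (y.1 ν : ℕ)) :=
        Finset.sum_congr rfl fun ν h => by rw [hν ν (Finset.ne_of_mem_erase h)]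
      omega
    have h1 := ih x' hx'b hsum
    have h2 := norm_del_le f y ⟨(x', x), μ, by simp only [hx']; omega, fun ν h => (hν ν h).symm⟩
      ((mem_box_iff hL x' y).1 hx'b) ((mem_box_iff hL x y).1 hx)
    rw [del_apply] at h2
    simp only at h2
    rw [norm_sub_rev] at h2
    calc ‖f x - f y.1‖ ≤ ‖f x - f x'‖ + ‖f x' - f y.1‖ := norm_sub_le_norm_sub_add_norm_sub ..
      _ ≤ _ := by push_cast; linarith

theorem norm_sub_corner_le {L n : ℕ} (hL : 0 < L) (f : Field n) (y : CoarseSite L n) (x : Site n)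
    (hx : x ∈ box y) : ‖f x - f y.1‖ ≤ 2 * L * Real.sqrt (boxEnergy f y) := by
  refine (norm_sub_corner_le_aux hL f y _ x hx rfl).trans ?_
  gcongr
  simp only [box, Finset.mem_filter, Finset.mem_univ, true_and] at hx
  have h : ∑ μ, ((x μ : ℕ) - (y.1 μ : ℕ)) ≤ 2 * L := by
    rw [Fin.sum_univ_two]
    have h0 := hx 0
    have h1 := hx 1
    omega
  exact_mod_cast h

theorem norm_sq_le_of_mem_box {L n : ℕ} (hL : 0 < L) (f : Field n) (y : CoarseSite L n)
    (x : Site n) (hx : x ∈ box y) :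
    ‖f x‖ ^ 2 ≤ 32 * L ^ 2 * (boxEnergy f y + L ^ 2 * ‖Q L n f y‖ ^ 2) := by
  set t := 2 * L * Real.sqrt (boxEnergy f y) with ht
  have ht2 : t ^ 2 = 4 * L ^ 2 * boxEnergy f y := by
    rw [ht, mul_pow, Real.sq_sqrt (boxEnergy_nonneg f y)]
    ring
  have hL1 : (1 : ℝ) ≤ L := by exact_mod_cast hL
  have hLne : (L : ℝ) ^ 2 ≠ 0 := by positivity
  obtain ⟨m, hm⟩ : ∃ m : ℝ, m = (box y).card := ⟨_, rfl⟩
  have hm1 : (1 : ℝ) ≤ m := by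
    rw [hm]
    exact_mod_cast card_box_pos hL y
  have hQ : (L : ℝ) ^ 2 • Q L n f y = ∑ x ∈ box y, f x := by
    rw [Q_apply, smul_smul, mul_inv_cancel₀ hLne, one_smul]
  -- The sum of `f` over the box is compared with `m` copies of the corner value; `m ≥ 1` then lets
  -- the corner be bounded even in a truncated box.
  have h1 : ‖∑ x ∈ box y, f x - m • f y.1‖ ≤ m * t := by
    have : ∑ x ∈ box y, f x - m • f y.1 = ∑ x ∈ box y, (f x - f y.1) := by
      rw [Finset.sum_sub_distrib, Finset.sum_const, ← Nat.cast_smul_eq_nsmul ℝ, hm]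
    rw [this]
    refine (norm_sum_le_of_le _ fun x hx => norm_sub_corner_le hL f y x hx).trans ?_
    rw [Finset.sum_const, nsmul_eq_mul, hm]
  have h2 : m * ‖f y.1‖ ≤ m * t + L ^ 2 * ‖Q L n f y‖ := by
    have e : ‖m • f y.1‖ ≤ ‖∑ x ∈ box y, f x - m • f y.1‖ + ‖∑ x ∈ box y, f x‖ := by
      rw [norm_sub_rev]
      have := norm_add_le (m • f y.1 - ∑ x ∈ box y, f x) (∑ x ∈ box y, f x)
      rwa [sub_add_cancel] at this
    rw [← hQ, norm_smul, norm_smul, Real.norm_of_nonneg (by positivity),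
      Real.norm_of_nonneg (by positivity), hQ] at e
    linarith
  have h3 : ‖f y.1‖ ≤ t + L ^ 2 * ‖Q L n f y‖ := by
    have hq : L ^ 2 * ‖Q L n f y‖ ≤ m * (L ^ 2 * ‖Q L n f y‖) :=
      le_mul_of_one_le_left (by positivity) hm1
    have : m * ‖f y.1‖ ≤ m * (t + L ^ 2 * ‖Q L n f y‖) := by linarith
    exact le_of_mul_le_mul_left this (by linarith)
  have h4 := norm_sub_corner_le hL f y x hx
  have h5 : ‖f x‖ ≤ 2 * t + L ^ 2 * ‖Q L n f y‖ := by
    have := norm_add_le (f x - f y.1) (f y.1)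
    rw [sub_add_cancel] at this
    linarith
  have h6 : ‖f x‖ ^ 2 ≤ 8 * t ^ 2 + 2 * (L ^ 2 * ‖Q L n f y‖) ^ 2 := by
    have := pow_le_pow_left₀ (norm_nonneg _) h5 2
    nlinarith [sq_nonneg (2 * t - L ^ 2 * ‖Q L n f y‖)]
  rw [ht2] at h6
  have : (0 : ℝ) ≤ (L ^ 2 * ‖Q L n f y‖) ^ 2 := by positivity
  nlinarith

/-- Poincaré inequality in a box. -/
theorem sum_box_norm_sq_le {L n : ℕ} (hL : 0 < L) (f : Field n) (y : CoarseSite L n) :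
    ∑ x ∈ box y, ‖f x‖ ^ 2 ≤ 32 * L ^ 4 * (boxEnergy f y + L ^ 2 * ‖Q L n f y‖ ^ 2) := by
  refine (Finset.sum_le_card_nsmul (box y) _ _ fun x hx => norm_sq_le_of_mem_box hL f y x hx).trans ?_
  have h0 := boxEnergy_nonneg f y
  have hc : ((box y).card : ℝ) ≤ L ^ 2 := by exact_mod_cast card_box_le y
  rw [nsmul_eq_mul]
  calc ((box y).card : ℝ) * (32 * L ^ 2 * (boxEnergy f y + L ^ 2 * ‖Q L n f y‖ ^ 2))
      ≤ (L : ℝ) ^ 2 * (32 * L ^ 2 * (boxEnergy f y + L ^ 2 * ‖Q L n f y‖ ^ 2)) := by gcongr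
    _ = _ := by ring

/-! ### Weighted coercivity -/

theorem sum_weight_boxEnergy {L n : ℕ} (W : CoarseSite L n → ℝ) (f : Field n) :
    ∑ y, W y * boxEnergy f y = ∑ b : Bond n,
      if label L b.1.1 = label L b.1.2 then W (label L b.1.1) * ‖del n f b‖ ^ 2 else 0 := by
  classical
  simp only [boxEnergy, Finset.mul_sum]
  rw [Finset.sum_comm]
  refine Finset.sum_congr rfl fun b _ => ?_
  rw [Finset.sum_eq_single (label L b.1.1)]
  · simp only [true_and, mul_ite, mul_zero]
    refine if_congr eq_comm rfl rfl
  · intro y _ hy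
    rw [if_neg fun h => hy h.1.symm, mul_zero]
  · simp

/-- Writing `p a - q b = p (a - b) - (q - p) b`, the term `p ‖a - b‖²` absorbs the cross term by
completing the square, so the loss is quadratic in `η`. -/
theorem inner_weighted_ge {p q η : ℝ} (hp : 0 ≤ p) (h1 : p ≤ q) (h2 : q ≤ (1 + η) * p)
    (a b : R3) : -(η ^ 2 / 4 * (p * ‖b‖ ^ 2)) ≤ inner ℝ (p • a - q • b) (a - b) := by
  have e : p • a - q • b = p • (a - b) - (q - p) • b := by
    rw [smul_sub, sub_smul]; abel
  rw [e, inner_sub_left, inner_smul_left, inner_smul_left, real_inner_self_eq_norm_sq]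
  simp only [conj_trivial]
  have h3 := real_inner_le_norm b (a - b)
  have h4 : (q - p) * inner ℝ b (a - b) ≤ η * p * (‖b‖ * ‖a - b‖) := by
    calc _ ≤ (q - p) * (‖b‖ * ‖a - b‖) := mul_le_mul_of_nonneg_left h3 (by linarith)
      _ ≤ _ := mul_le_mul_of_nonneg_right (by linarith) (by positivity)
  have h5 : 0 ≤ p * (‖a - b‖ - η / 2 * ‖b‖) ^ 2 := by positivity
  nlinarith

theorem inner_weighted_ge_symm {p q η : ℝ} (hp : 0 ≤ p) (hq : 0 ≤ q)
    (h1 : p ≤ (1 + η) * q) (h2 : q ≤ (1 + η) * p) (a b : R3) :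
    -(η ^ 2 / 4 * (p * ‖a‖ ^ 2 + q * ‖b‖ ^ 2)) ≤ inner ℝ (p • a - q • b) (a - b) := by
  have hη2 : 0 ≤ η ^ 2 / 4 := by positivity
  rcases le_total p q with h | h
  · refine le_trans ?_ (inner_weighted_ge hp h h2 a b)
    have : p * ‖b‖ ^ 2 ≤ p * ‖a‖ ^ 2 + q * ‖b‖ ^ 2 := by
      have : p * ‖b‖ ^ 2 ≤ q * ‖b‖ ^ 2 := by gcongr
      have : 0 ≤ p * ‖a‖ ^ 2 := by positivity
      linarith
    have := mul_le_mul_of_nonneg_left this hη2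
    linarith
  · have h3 := inner_weighted_ge hq h h1 b a
    rw [← neg_sub (p • a), ← neg_sub a b, inner_neg_neg] at h3
    refine le_trans ?_ h3
    have : q * ‖a‖ ^ 2 ≤ p * ‖a‖ ^ 2 + q * ‖b‖ ^ 2 := by
      have : q * ‖a‖ ^ 2 ≤ p * ‖a‖ ^ 2 := by gcongr
      have : 0 ≤ q * ‖b‖ ^ 2 := by positivity
      linarith
    have := mul_le_mul_of_nonneg_left this hη2
    linarith

/-- A direction of a bond. -/
def Bond.dir {n : ℕ} (b : Bond n) : Fin 2 := b.2.choose

theorem Bond.dir_spec {n : ℕ} (b : Bond n) :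
    (b.1.2 b.dir : ℕ) = (b.1.1 b.dir : ℕ) + 1 ∧ ∀ ν, ν ≠ b.dir → b.1.2 ν = b.1.1 ν :=
  b.2.choose_spec

/-- If a bond is determined by the chosen endpoint and its direction, each site is counted at most
twice. -/
theorem sum_bond_le_of_injective {n : ℕ} (e : Bond n → Site n)
    (he : Function.Injective fun b : Bond n => (e b, b.dir)) (F : Site n → ℝ) (hF : ∀ x, 0 ≤ F x) :
    ∑ b : Bond n, F (e b) ≤ 2 * ∑ x, F x := by
  classical
  calc ∑ b : Bond n, F (e b)
      = ∑ p ∈ Finset.univ.image (fun b : Bond n => (e b, b.dir)), F p.1 := by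
        rw [Finset.sum_image fun a _ b _ h => he h]
    _ ≤ ∑ p : Site n × Fin 2, F p.1 :=
        Finset.sum_le_sum_of_subset_of_nonneg (Finset.subset_univ _) fun p _ _ => hF _
    _ = 2 * ∑ x, F x := by
        rw [Fintype.sum_prod_type]
        simp [Finset.mul_sum]

theorem sum_bond_fst_le {n : ℕ} (F : Site n → ℝ) (hF : ∀ x, 0 ≤ F x) :
    ∑ b : Bond n, F b.1.1 ≤ 2 * ∑ x, F x := by
  refine sum_bond_le_of_injective (fun b => b.1.1) (fun b b' h => ?_) F hF
  simp only [Prod.mk.injEq] at h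
  obtain ⟨h1, h2⟩ := h
  apply Subtype.ext
  refine Prod.ext h1 ?_
  funext ν
  by_cases hν : ν = b.dir
  · have e1 := b.dir_spec.1
    have e2 := b'.dir_spec.1
    rw [← h2, ← h1] at e2
    apply Fin.ext
    rw [hν]
    omega
  · rw [b.dir_spec.2 ν hν, b'.dir_spec.2 ν (h2 ▸ hν), h1]

theorem sum_bond_snd_le {n : ℕ} (F : Site n → ℝ) (hF : ∀ x, 0 ≤ F x) :
    ∑ b : Bond n, F b.1.2 ≤ 2 * ∑ x, F x := by
  refine sum_bond_le_of_injective (fun b => b.1.2) (fun b b' h => ?_) F hF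
  simp only [Prod.mk.injEq] at h
  obtain ⟨h1, h2⟩ := h
  apply Subtype.ext
  refine Prod.ext ?_ h1
  funext ν
  by_cases hν : ν = b.dir
  · have e1 := b.dir_spec.1
    have e2 := b'.dir_spec.1
    rw [← h2, ← h1] at e2
    apply Fin.ext
    rw [hν]
    omega
  · rw [← b.dir_spec.2 ν hν, ← b'.dir_spec.2 ν (h2 ▸ hν), h1]

/-- Weighted coercivity of `-Δ + Q*Q` for a slowly varying weight. -/
theorem weighted_coercive {L n : ℕ} (hL : 0 < L) {η : ℝ} (W : CoarseSite L n → ℝ)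
    (hW : ∀ y, 0 ≤ W y)
    (h1 : ∀ b : Bond n, W (label L b.1.1) ≤ (1 + η) * W (label L b.1.2))
    (h2 : ∀ b : Bond n, W (label L b.1.2) ≤ (1 + η) * W (label L b.1.1)) (f : Field n) :
    (1 / (32 * L ^ 4) - η ^ 2) * ∑ x, W (label L x) * ‖f x‖ ^ 2 ≤ ip (weightMul W f) (K L n f) := by
  set N := ∑ x, W (label L x) * ‖f x‖ ^ 2 with hN
  have hF : ∀ x : Site n, 0 ≤ W (label L x) * ‖f x‖ ^ 2 := fun x => mul_nonneg (hW _) (by positivity)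
  have hpoin : N ≤ 32 * L ^ 4 * ∑ y, W y * (boxEnergy f y + L ^ 2 * ‖Q L n f y‖ ^ 2) := by
    rw [hN, ← sum_box hL, Finset.mul_sum]
    refine Finset.sum_le_sum fun y _ => ?_
    have : ∑ x ∈ box y, W (label L x) * ‖f x‖ ^ 2 = W y * ∑ x ∈ box y, ‖f x‖ ^ 2 := by
      rw [Finset.mul_sum]
      exact Finset.sum_congr rfl fun x hx => by rw [(mem_box_iff hL x y).1 hx]
    rw [this]
    have := mul_le_mul_of_nonneg_left (sum_box_norm_sq_le hL f y) (hW y)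
    linarith
  have hcoarse : coarseIp (Q L n (weightMul W f)) (Q L n f)
      = ∑ y, W y * (L ^ 2 * ‖Q L n f y‖ ^ 2) := by
    simp only [coarseIp, Finset.mul_sum, Q_weightMul hL, inner_smul_left, conj_trivial,
      real_inner_self_eq_norm_sq]
    exact Finset.sum_congr rfl fun y _ => by ring
  have hbond : ∑ y, W y * boxEnergy f y - η ^ 2 * N
      ≤ bondIp (del n (weightMul W f)) (del n f) := by
    have hb : ∑ b : Bond n, (W (label L b.1.1) * ‖f b.1.1‖ ^ 2 + W (label L b.1.2) * ‖f b.1.2‖ ^ 2)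
        ≤ 4 * N := by
      rw [Finset.sum_add_distrib]
      have := sum_bond_fst_le _ hF
      have := sum_bond_snd_le _ hF
      linarith
    have hb2 := mul_le_mul_of_nonneg_left hb (show 0 ≤ η ^ 2 / 4 by positivity)
    have hb3 : ∑ y, W y * boxEnergy f y - η ^ 2 / 4 * ∑ b : Bond n,
        (W (label L b.1.1) * ‖f b.1.1‖ ^ 2 + W (label L b.1.2) * ‖f b.1.2‖ ^ 2)
        ≤ bondIp (del n (weightMul W f)) (del n f) := by
      rw [sum_weight_boxEnergy, bondIp, Finset.mul_sum, ← Finset.sum_sub_distrib]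
      refine Finset.sum_le_sum fun b _ => ?_
      rw [del_apply, del_apply, weightMul, weightMul]
      have hpos : 0 ≤ η ^ 2 / 4 * (W (label L b.1.1) * ‖f b.1.1‖ ^ 2 +
        W (label L b.1.2) * ‖f b.1.2‖ ^ 2) :=
        mul_nonneg (by positivity) (add_nonneg (hF _) (hF _))
      split_ifs with h
      -- Inside a box the weight is constant, so the full energy is kept for Poincaré. A bond
      -- between boxes contributes nothing to the box energies and only has to be bounded below.
      · rw [← h] at hpos ⊢
        rw [← smul_sub, inner_smul_left, real_inner_self_eq_norm_sq, conj_trivial]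
        linarith
      · rw [zero_sub]
        exact inner_weighted_ge_symm (hW _) (hW _) (h1 b) (h2 b) _ _
    linarith
  rw [ip_K_bilin hL, hcoarse]
  simp only [mul_add, Finset.sum_add_distrib] at hpoin
  have hL4 : (0 : ℝ) < 32 * L ^ 4 := by positivity
  have : 1 / (32 * L ^ 4) * N ≤ ∑ y, W y * boxEnergy f y + ∑ y, W y * (L ^ 2 * ‖Q L n f y‖ ^ 2) := by
    rw [one_div, inv_mul_le_iff₀ hL4]
    linarith
  linarith

/-! ### Exponential weights and the sup-norm estimate -/

theorem sum_range_pow_le {θ : ℝ} (h0 : 0 ≤ θ) (h1 : θ < 1) (n : ℕ) :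
    ∑ i ∈ Finset.range n, θ ^ i ≤ (1 - θ)⁻¹ := by
  rw [← tsum_geometric_of_lt_one h0 h1]
  exact (summable_geometric_of_lt_one h0 h1).sum_le_tsum _ fun i _ => pow_nonneg h0 i

theorem sum_range_pow_dist_le {θ : ℝ} (h0 : 0 ≤ θ) (h1 : θ < 1) (n k : ℕ) :
    ∑ j ∈ Finset.range n, θ ^ ((j - k) + (k - j)) ≤ 2 * (1 - θ)⁻¹ := by
  -- Enlarging the range lets the sum split exactly at `k` into two geometric sums, wherever `k`
  -- lies.
  have hsub : Finset.range n ⊆ Finset.range (k + n) := Finset.range_mono (by omega)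
  refine (Finset.sum_le_sum_of_subset_of_nonneg hsub fun _ _ _ => pow_nonneg h0 _).trans ?_
  rw [Finset.sum_range_add]
  have e1 : ∑ j ∈ Finset.range k, θ ^ ((j - k) + (k - j)) ≤ (1 - θ)⁻¹ := by
    refine le_trans ?_ (sum_range_pow_le h0 h1 k)
    rw [← Finset.sum_range_reflect (fun i => θ ^ i) k]
    refine Finset.sum_le_sum fun j _ => pow_le_pow_of_le_one h0 h1.le ?_
    omega
  have e2 : ∑ j ∈ Finset.range n, θ ^ ((k + j - k) + (k - (k + j))) ≤ (1 - θ)⁻¹ := by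
    refine le_of_eq_of_le (Finset.sum_congr rfl fun j _ => ?_) (sum_range_pow_le h0 h1 n)
    congr 1
    omega
  linarith

theorem sum_range_mul_div {L : ℕ} (hL : 0 < L) (g : ℕ → ℝ) (n : ℕ) :
    ∑ i ∈ Finset.range (L * n), g (i / L) = L * ∑ j ∈ Finset.range n, g j := by
  induction n with
  | zero => simp
  | succ n ih =>
    rw [mul_add, mul_one, Finset.sum_range_add, ih, Finset.sum_range_succ, mul_add]
    congr 1
    rw [Finset.sum_congr rfl fun r hr => by
      rw [Nat.mul_add_div hL, Nat.div_eq_of_lt (Finset.mem_range.1 hr), add_zero]]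
    simp

/-- The distance of two coarse sites, in units of `L`. -/
def coarseDist {L n : ℕ} (y z : CoarseSite L n) : ℕ :=
  ∑ μ, (((y.1 μ : ℕ) / L - (z.1 μ : ℕ) / L) + ((z.1 μ : ℕ) / L - (y.1 μ : ℕ) / L))

theorem label_div {L n : ℕ} (hL : 0 < L) (x : Site n) (μ : Fin 2) :
    ((label L x).1 μ : ℕ) / L = (x μ : ℕ) / L := by
  simp [label, Nat.mul_div_cancel_left _ hL]

theorem coarseDist_self {L n : ℕ} (y : CoarseSite L n) : coarseDist y y = 0 := by
  simp [coarseDist]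

theorem coarseDist_bond {L n : ℕ} (hL : 0 < L) (z : CoarseSite L n) (b : Bond n) :
    coarseDist (label L b.1.1) z ≤ coarseDist (label L b.1.2) z + 1 ∧
      coarseDist (label L b.1.2) z ≤ coarseDist (label L b.1.1) z + 1 := by
  obtain ⟨h1, h2⟩ := b.dir_spec
  have hdiv : (b.1.2 b.dir : ℕ) / L ≤ (b.1.1 b.dir : ℕ) / L + 1 := by
    rw [h1, ← Nat.add_div_right _ hL]
    exact Nat.div_le_div_right (by omega)
  have hdiv' : (b.1.1 b.dir : ℕ) / L ≤ (b.1.2 b.dir : ℕ) / L := Nat.div_le_div_right (by omega)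
  simp only [coarseDist, label_div hL]
  rw [← Finset.add_sum_erase _ _ (Finset.mem_univ b.dir),
    ← Finset.add_sum_erase Finset.univ (fun μ => ((b.1.2 μ : ℕ) / L - (z.1 μ : ℕ) / L) +
      ((z.1 μ : ℕ) / L - (b.1.2 μ : ℕ) / L)) (Finset.mem_univ b.dir)]
  have e : ∑ μ ∈ Finset.univ.erase b.dir, (((b.1.2 μ : ℕ) / L - (z.1 μ : ℕ) / L) +
      ((z.1 μ : ℕ) / L - (b.1.2 μ : ℕ) / L)) =
      ∑ μ ∈ Finset.univ.erase b.dir, (((b.1.1 μ : ℕ) / L - (z.1 μ : ℕ) / L) +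
      ((z.1 μ : ℕ) / L - (b.1.1 μ : ℕ) / L)) :=
    Finset.sum_congr rfl fun ν h => by rw [h2 ν (Finset.ne_of_mem_erase h)]
  rw [e]
  constructor <;> omega

theorem sum_pow_coarseDist_le {L n : ℕ} (hL : 0 < L) {θ : ℝ} (h0 : 0 ≤ θ) (h1 : θ < 1)
    (z : CoarseSite L n) :
    ∑ x : Site n, θ ^ coarseDist (label L x) z ≤ (L * (2 * (1 - θ)⁻¹)) ^ 2 := by
  let g : Fin 2 → Fin n → ℝ := fun μ i =>
    θ ^ (((i : ℕ) / L - (z.1 μ : ℕ) / L) + ((z.1 μ : ℕ) / L - (i : ℕ) / L))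
  have e : ∑ x : Site n, θ ^ coarseDist (label L x) z = ∏ μ, ∑ i, g μ i := by
    rw [Finset.prod_univ_sum, Fintype.piFinset_univ]
    refine Finset.sum_congr rfl fun x _ => ?_
    simp only [coarseDist, label_div hL, g, Finset.prod_pow_eq_pow_sum]
  rw [e]
  have hg : ∀ μ, ∑ i, g μ i ≤ L * (2 * (1 - θ)⁻¹) := by
    intro μ
    let a : ℕ → ℝ := fun j => θ ^ ((j - (z.1 μ : ℕ) / L) + ((z.1 μ : ℕ) / L - j))
    calc ∑ i, g μ i = ∑ i ∈ Finset.range n, a (i / L) :=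
          Fin.sum_univ_eq_sum_range (fun i => a (i / L)) n
      -- Enlarging to `L * n` terms makes every block of constant quotient complete.
      _ ≤ ∑ i ∈ Finset.range (L * n), a (i / L) :=
          Finset.sum_le_sum_of_subset_of_nonneg
            (Finset.range_mono (Nat.le_mul_of_pos_left n hL)) fun _ _ _ => pow_nonneg h0 _
      _ = L * ∑ j ∈ Finset.range n, a j := sum_range_mul_div hL a n
      _ ≤ _ := mul_le_mul_of_nonneg_left (sum_range_pow_dist_le h0 h1 n _) (by positivity)
  calc ∏ μ, ∑ i, g μ i ≤ ∏ _μ : Fin 2, (L * (2 * (1 - θ)⁻¹)) :=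
        Finset.prod_le_prod (fun μ _ => Finset.sum_nonneg fun i _ => pow_nonneg h0 _)
          fun μ _ => hg μ
    _ = _ := by simp

/-- The equation `K f = h` is assumed only when tested against `W f` with `W` constant on boxes.
This weak form allows `h` to differ from `K f` by an element of the range of `Q*` when `Q f = 0`. -/
theorem exists_sup_bound {L : ℕ} (hL : 0 < L) : ∃ C : ℝ, 0 < C ∧ ∀ (n : ℕ) (f h : Field n) (M : ℝ),
    0 ≤ M → (∀ x, ‖h x‖ ≤ M) →
    (∀ W : CoarseSite L n → ℝ, ip (weightMul W f) (K L n f) = ip (weightMul W f) h) →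
    ∀ x, ‖f x‖ ≤ C * M := by
  set γ : ℝ := 1 / (32 * L ^ 4) with hγ
  have hL1 : (1 : ℝ) ≤ L := by exact_mod_cast hL
  have hγ0 : 0 < γ := by positivity
  have hγ1 : γ ≤ 1 := by
    rw [hγ, div_le_one (by positivity)]
    have : (1 : ℝ) ≤ L ^ 4 := one_le_pow₀ hL1
    linarith
  -- Since `γ ≤ 1`, this gives `η² ≤ γ / 2`, so half of the coercivity remains; `θ = 1 / (1 + η)` is
  -- the decay rate whose weight changes by at most `1 + η` per bond.
  set η : ℝ := γ / 2 with hη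
  have hη0 : 0 < η := by positivity
  set θ : ℝ := (1 + η)⁻¹ with hθ
  have hθ0 : 0 < θ := by positivity
  have hθ1 : θ < 1 := inv_lt_one_of_one_lt₀ (by linarith)
  have hθη : (1 + η) * θ = 1 := mul_inv_cancel₀ (by positivity)
  set S : ℝ := (L * (2 * (1 - θ)⁻¹)) ^ 2 with hS
  have h1θ : 0 < 1 - θ := by linarith
  have hS0 : 0 < S := by positivity
  refine ⟨2 / γ * Real.sqrt S, by positivity, fun n f h M hM hh hw x₀ => ?_⟩
  set z := label L x₀ with hz
  let W : CoarseSite L n → ℝ := fun y => θ ^ coarseDist y z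
  have hW0 : ∀ y, 0 ≤ W y := fun y => pow_nonneg hθ0.le _
  have hstep : ∀ a b : ℕ, b ≤ a + 1 → θ ^ a ≤ (1 + η) * θ ^ b := by
    intro a b hab
    calc θ ^ a = (1 + η) * θ ^ (a + 1) := by rw [pow_succ, mul_left_comm, hθη, mul_one]
      _ ≤ _ := mul_le_mul_of_nonneg_left (pow_le_pow_of_le_one hθ0.le hθ1.le hab) (by positivity)
  have hco := weighted_coercive hL (η := η) W hW0
    (fun b => hstep _ _ (coarseDist_bond hL z b).2)
    (fun b => hstep _ _ (coarseDist_bond hL z b).1) f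
  rw [hw W, ← hγ] at hco
  set N := ∑ x, W (label L x) * ‖f x‖ ^ 2 with hN
  have hN0 : 0 ≤ N := Finset.sum_nonneg fun x _ => mul_nonneg (hW0 _) (by positivity)
  have hup : ip (weightMul W f) h ≤ γ / 4 * N + M ^ 2 / γ * S := by
    have hs : ∑ x : Site n, W (label L x) ≤ S := sum_pow_coarseDist_le hL hθ0.le hθ1 z
    refine le_trans ?_ (add_le_add_right (mul_le_mul_of_nonneg_left hs
      (show 0 ≤ M ^ 2 / γ by positivity)) _)
    rw [hN, Finset.mul_sum, Finset.mul_sum, ← Finset.sum_add_distrib, ip]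
    refine Finset.sum_le_sum fun x _ => ?_
    rw [weightMul, inner_smul_left, conj_trivial]
    have e1 : inner ℝ (f x) (h x) ≤ ‖f x‖ * M :=
      (real_inner_le_norm _ _).trans (mul_le_mul_of_nonneg_left (hh x) (norm_nonneg _))
    -- Young's inequality, with `γ / 4` chosen to be absorbed by the remaining coercivity `γ / 2`.
    have e2 : ‖f x‖ * M ≤ γ / 4 * ‖f x‖ ^ 2 + M ^ 2 / γ := by
      have : γ / 4 * ‖f x‖ ^ 2 + M ^ 2 / γ - ‖f x‖ * M
          = (γ / 2 * ‖f x‖ - M) ^ 2 / γ := by field_simp; ring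
      have : 0 ≤ (γ / 2 * ‖f x‖ - M) ^ 2 / γ := by positivity
      linarith
    have := mul_le_mul_of_nonneg_left (e1.trans e2) (hW0 (label L x))
    linarith
  have hη2 : η ^ 2 ≤ γ / 2 := by rw [hη]; nlinarith
  have hlow : γ / 2 * N ≤ (γ - η ^ 2) * N := mul_le_mul_of_nonneg_right (by linarith) hN0
  have hNle : N ≤ (2 / γ) ^ 2 * S * M ^ 2 := by
    have : γ / 4 * N ≤ M ^ 2 / γ * S := by linarith
    calc N = 4 / γ * (γ / 4 * N) := by field_simp
      _ ≤ 4 / γ * (M ^ 2 / γ * S) := mul_le_mul_of_nonneg_left this (by positivity)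
      _ = _ := by field_simp; ring
  have hx0 : ‖f x₀‖ ^ 2 ≤ N := by
    have := Finset.single_le_sum (s := Finset.univ)
      (f := fun x : Site n => W (label L x) * ‖f x‖ ^ 2)
      (fun x _ => mul_nonneg (hW0 _) (by positivity)) (Finset.mem_univ x₀)
    simp only [W, ← hz, coarseDist_self, pow_zero, one_mul] at this
    exact this
  refine le_of_sq_le_sq ?_ (by positivity)
  rw [mul_pow, mul_pow, Real.sq_sqrt hS0.le]
  exact hx0.trans hNle

theorem K_G_apply {L : ℕ} (hL : 0 < L) {n : ℕ} (f : Field n) : K L n (G L n f) = f :=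
  congrArg (fun T : Field n →L[ℝ] Field n => T f) (Ring.mul_inverse_cancel _ (isUnit_K hL n))

theorem exists_norm_G_le {L : ℕ} (hL : 0 < L) : ∃ C : ℝ, 0 < C ∧ ∀ n, ‖G L n‖ ≤ C := by
  obtain ⟨C, hC, h⟩ := exists_sup_bound hL
  refine ⟨C, hC, fun n => ContinuousLinearMap.opNorm_le_bound _ hC.le fun f => ?_⟩
  rw [pi_norm_le_iff_of_nonneg (by positivity)]
  exact h n (G L n f) f ‖f‖ (norm_nonneg _) (norm_le_pi_norm f) fun W => by rw [K_G_apply hL]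

/-! ### Lower bound for `Q G Q*` -/

theorem norm_Q_apply_le {L n : ℕ} (hL : 0 < L) (f : Field n) : ‖Q L n f‖ ≤ ‖f‖ := by
  rw [pi_norm_le_iff_of_nonneg (norm_nonneg _)]
  intro y
  have hL2 : (0 : ℝ) < (L : ℝ) ^ 2 := by positivity
  have hc : ((box y).card : ℝ) ≤ L ^ 2 := by exact_mod_cast card_box_le y
  rw [Q_apply, norm_smul, Real.norm_of_nonneg (by positivity), inv_mul_le_iff₀ hL2]
  refine (norm_sum_le_of_le _ fun x _ => norm_le_pi_norm f x).trans ?_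
  rw [Finset.sum_const, nsmul_eq_mul]
  gcongr

theorem norm_Qstar_apply_le {L n : ℕ} (f : CoarseField L n) : ‖Qstar L n f‖ ≤ ‖f‖ := by
  rw [pi_norm_le_iff_of_nonneg (norm_nonneg _)]
  exact fun x => norm_le_pi_norm f _

theorem delStar_apply (n : ℕ) (g : BondField n) (x : Site n) : delStar n g x =
    ∑ b : Bond n, ((if b.1.1 = x then g b else 0) - (if b.1.2 = x then g b else 0)) := by
  simp only [delStar, LinearMap.coe_toContinuousLinearMap', LinearMap.coe_mk, AddHom.coe_mk]

/-- At most four bonds meet a site, and on each the derivative is at most `2 ‖f‖`. -/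
theorem norm_laplacian_apply_le {n : ℕ} (f : Field n) (x : Site n) :
    ‖laplacian n f x‖ ≤ 8 * ‖f‖ := by
  have hdel : ∀ b, ‖del n f b‖ ≤ 2 * ‖f‖ := fun b => by
    rw [del_apply]
    have h1 := norm_le_pi_norm f b.1.1
    have h2 := norm_le_pi_norm f b.1.2
    have h3 := norm_sub_le (f b.1.1) (f b.1.2)
    linarith
  let F : Site n → ℝ := fun x' => if x' = x then 2 * ‖f‖ else 0
  have hF : ∀ x', 0 ≤ F x' := fun x' => by
    simp only [F]
    split_ifs <;> positivity
  have hsum : ∑ x', F x' = 2 * ‖f‖ := by simp [F]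
  have e : laplacian n f x = -delStar n (del n f) x := rfl
  rw [e, norm_neg, delStar_apply]
  calc _ ≤ ∑ b : Bond n, (F b.1.1 + F b.1.2) := by
        refine norm_sum_le_of_le _ fun b _ => (norm_sub_le _ _).trans (add_le_add ?_ ?_)
        · simp only [F]
          split_ifs
          · exact hdel b
          · simp
        · simp only [F]
          split_ifs
          · exact hdel b
          · simp
    _ ≤ 8 * ‖f‖ := by
        rw [Finset.sum_add_distrib]
        have := sum_bond_fst_le F hF
        have := sum_bond_snd_le F hF
        linarith

theorem K_apply (L n : ℕ) (f : Field n) :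
    K L n f = -laplacian n f + Qstar L n (Q L n f) := rfl

/-- A right inverse of `Q`. -/
def extend {L n : ℕ} (g : CoarseField L n) : Field n :=
  fun x => ((L : ℝ) ^ 2 / (box (label L x)).card) • g (label L x)

theorem Q_extend {L n : ℕ} (hL : 0 < L) (g : CoarseField L n) : Q L n (extend g) = g := by
  funext y
  have hL2 : (L : ℝ) ^ 2 ≠ 0 := by positivity
  have hm : ((box y).card : ℝ) ≠ 0 := by
    have := card_box_pos hL y
    positivity
  rw [Q_apply, Finset.sum_congr rfl fun x hx => by rw [extend, (mem_box_iff hL x y).1 hx],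
    Finset.sum_const, ← Nat.cast_smul_eq_nsmul ℝ, smul_smul, smul_smul]
  rw [show ((L : ℝ) ^ 2)⁻¹ * (box y).card * ((L : ℝ) ^ 2 / (box y).card) = 1 by field_simp,
    one_smul]

/-- The factor `L ^ 2` allows for truncated boxes, of which only one site is guaranteed. -/
theorem norm_extend_le {L n : ℕ} (hL : 0 < L) (g : CoarseField L n) :
    ‖extend g‖ ≤ L ^ 2 * ‖g‖ := by
  rw [pi_norm_le_iff_of_nonneg (by positivity)]
  intro x
  have hm : (1 : ℝ) ≤ (box (label L x)).card := by exact_mod_cast card_box_pos hL _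
  rw [extend, norm_smul, Real.norm_of_nonneg (by positivity)]
  gcongr
  · exact div_le_self (by positivity) hm
  · exact norm_le_pi_norm g _

theorem exists_norm_le_QGQstar {L : ℕ} (hL : 0 < L) : ∃ C : ℝ, 0 < C ∧
    ∀ (n : ℕ) (f : CoarseField L n), ‖f‖ ≤ C * ‖Q L n (G L n (Qstar L n f))‖ := by
  obtain ⟨C, hC, h⟩ := exists_sup_bound hL
  refine ⟨1 + 8 * (C * (8 * L ^ 2) + L ^ 2), by positivity, fun n f => ?_⟩
  set u := G L n (Qstar L n f) with hu
  set g := Q L n u with hg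
  have hKu : K L n u = Qstar L n f := K_G_apply hL _
  have hlap : -laplacian n u = Qstar L n (f - g) := by
    rw [K_apply, ← hg] at hKu
    rw [map_sub, ← hKu, add_sub_cancel_right]
  have hE := norm_extend_le hL g
  have hphi : ∀ x, ‖(u - extend g) x‖ ≤ C * (8 * L ^ 2 * ‖g‖) := by
    refine h n (u - extend g) (laplacian n (extend g)) _ (by positivity)
      (fun x => (norm_laplacian_apply_le _ x).trans (by linarith)) fun W => ?_
    have hQ : Q L n (u - extend g) = 0 := by rw [map_sub, Q_extend hL, ← hg, sub_self]
    have hK : K L n (u - extend g) = Qstar L n (f - g) + laplacian n (extend g) := by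
      rw [K_apply, hQ, map_zero, add_zero, map_sub, neg_sub', hlap, sub_neg_eq_add]
    -- The uncontrolled source `Q*(f - g)` drops out: moving `Q*` across gives `Q (W φ) = W Q φ = 0`
    -- for `φ = u - extend g`.
    have hz : ip (weightMul W (u - extend g)) (Qstar L n (f - g)) = 0 := by
      rw [← Q_adjoint hL]
      simp [coarseIp, Q_weightMul hL, hQ]
    rw [hK]
    have : ∀ a b c : Field n, ip a (b + c) = ip a b + ip a c := fun a b c => by
      simp [ip, inner_add_right, Finset.sum_add_distrib]
    rw [this, hz, zero_add]
  have hphi' : ‖u - extend g‖ ≤ C * (8 * L ^ 2 * ‖g‖) :=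
    (pi_norm_le_iff_of_nonneg (by positivity)).2 hphi
  have hun : ‖u‖ ≤ (C * (8 * L ^ 2) + L ^ 2) * ‖g‖ := by
    have := norm_add_le (u - extend g) (extend g)
    rw [sub_add_cancel] at this
    linarith
  -- Evaluating `-Δu = Q*(f - g)` at the coarse site `y` itself recovers `(f - g) y`.
  have he : ‖f - g‖ ≤ 8 * ‖u‖ := by
    rw [pi_norm_le_iff_of_nonneg (by positivity)]
    intro y
    have h1 : (f - g) y = -laplacian n u y.1 := by
      have h2 := congrFun hlap y.1
      rw [Qstar_apply, (mem_box_iff hL _ y).1 (coarse_mem_box hL y)] at h2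
      exact h2.symm
    rw [h1, norm_neg]
    exact norm_laplacian_apply_le u _
  have := norm_add_le (f - g) g
  rw [sub_add_cancel] at this
  linarith

/-! ### Dependence on `A` and perturbation around `A = 0` -/

theorem norm_cross_le (a v : R3) : ‖cross a v‖ ≤ ‖a‖ * ‖v‖ := by
  refine le_of_sq_le_sq ?_ (by positivity)
  rw [mul_pow]
  simp only [EuclideanSpace.norm_sq_eq, Fin.sum_univ_three, cross, cross_apply, Real.norm_eq_abs,
    sq_abs]
  simp
  -- Lagrange's identity: the defect is the square of `a · v`.
  nlinarith [sq_nonneg (a 0 * v 0 + a 1 * v 1 + a 2 * v 2)]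

theorem cross_sub_left (a b v : R3) : cross (a - b) v = cross a v - cross b v := by
  simp [cross]

/-- The difference of squares of the scalar parts is that of the norms, up to sign. The radius `1 /
2` makes the scalar parts add up to at least one and the norms to at most one, giving Lipschitz
constant one. -/
theorem abs_scalarPart_sub_le {a b : R3} (ha : ‖a‖ ≤ 1 / 2) (hb : ‖b‖ ≤ 1 / 2) :
    |scalarPart a - scalarPart b| ≤ ‖a - b‖ := by
  have key : ∀ c : R3, ‖c‖ ≤ 1 / 2 →
      1 / 2 ≤ scalarPart c ∧ scalarPart c ^ 2 = 1 - ‖c‖ ^ 2 := fun c hc => by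
    have h1 : ‖c‖ ^ 2 ≤ 1 / 4 := by nlinarith [norm_nonneg c]
    exact ⟨Real.le_sqrt_of_sq_le (by linarith), Real.sq_sqrt (by linarith)⟩
  obtain ⟨ha1, ha2⟩ := key a ha
  obtain ⟨hb1, hb2⟩ := key b hb
  have h1 : |scalarPart a - scalarPart b| * (scalarPart a + scalarPart b)
      = |‖a‖ - ‖b‖| * (‖a‖ + ‖b‖) := by
    rw [← abs_of_nonneg (show 0 ≤ scalarPart a + scalarPart b by linarith), ← abs_mul,
      ← abs_of_nonneg (show 0 ≤ ‖a‖ + ‖b‖ by positivity), ← abs_mul, ← abs_neg]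
    congr 1
    linarith
  calc |scalarPart a - scalarPart b|
      ≤ |scalarPart a - scalarPart b| * (scalarPart a + scalarPart b) :=
        le_mul_of_one_le_right (abs_nonneg _) (by linarith)
    _ = |‖a‖ - ‖b‖| * (‖a‖ + ‖b‖) := h1
    _ ≤ |‖a‖ - ‖b‖| := mul_le_of_le_one_right (abs_nonneg _) (by linarith)
    _ ≤ _ := abs_norm_sub_norm_le a b

theorem Rstar_apply {n : ℕ} (A v : Field n) (x : Site n) :
    Rstar A v x = scalarPart (A x) • v x - cross (A x) (v x) := rfl

theorem Rstar_zero_apply {n : ℕ} (v : Field n) : Rstar 0 v = v := by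
  funext x
  simp [Rstar_apply, scalarPart, cross]

theorem norm_Rstar_sub_apply_le {n : ℕ} {A₁ A₂ : Field n} (h₁ : ∀ x, ‖A₁ x‖ ≤ 1 / 2)
    (h₂ : ∀ x, ‖A₂ x‖ ≤ 1 / 2) (v : Field n) :
    ‖Rstar A₁ v - Rstar A₂ v‖ ≤ 2 * ‖A₁ - A₂‖ * ‖v‖ := by
  rw [pi_norm_le_iff_of_nonneg (by positivity)]
  intro x
  have e : (Rstar A₁ v - Rstar A₂ v) x
      = (scalarPart (A₁ x) - scalarPart (A₂ x)) • v x - cross (A₁ x - A₂ x) (v x) := by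
    rw [Pi.sub_apply, Rstar_apply, Rstar_apply, cross_sub_left, sub_smul]
    abel
  have hA : ‖A₁ x - A₂ x‖ ≤ ‖A₁ - A₂‖ := norm_le_pi_norm (A₁ - A₂) x
  have hs : ‖(scalarPart (A₁ x) - scalarPart (A₂ x)) • v x‖ ≤ ‖A₁ x - A₂ x‖ * ‖v x‖ := by
    rw [norm_smul, Real.norm_eq_abs]
    exact mul_le_mul_of_nonneg_right (abs_scalarPart_sub_le (h₁ x) (h₂ x)) (norm_nonneg _)
  have hc := norm_cross_le (A₁ x - A₂ x) (v x)
  have hv : ‖A₁ x - A₂ x‖ * ‖v x‖ ≤ ‖A₁ - A₂‖ * ‖v‖ :=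
    mul_le_mul hA (norm_le_pi_norm v x) (norm_nonneg _) (norm_nonneg _)
  rw [e]
  refine (norm_sub_le _ _).trans ?_
  linarith

theorem norm_D_sub_apply_le {L n : ℕ} (hL : 0 < L) {A₁ A₂ : Field n} (h₁ : ∀ x, ‖A₁ x‖ ≤ 1 / 2)
    (h₂ : ∀ x, ‖A₂ x‖ ≤ 1 / 2) (f : CoarseField L n) :
    ‖D L A₁ f - D L A₂ f‖ ≤ 2 * ‖G L n‖ * ‖A₁ - A₂‖ * ‖f‖ := by
  have e : D L A₁ f - D L A₂ f
      = Q L n (G L n (Rstar A₁ (Qstar L n f) - Rstar A₂ (Qstar L n f))) := by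
    rw [map_sub, map_sub]
    rfl
  rw [e]
  calc _ ≤ ‖G L n (Rstar A₁ (Qstar L n f) - Rstar A₂ (Qstar L n f))‖ := norm_Q_apply_le hL _
    _ ≤ ‖G L n‖ * ‖Rstar A₁ (Qstar L n f) - Rstar A₂ (Qstar L n f)‖ :=
        ContinuousLinearMap.le_opNorm _ _
    _ ≤ ‖G L n‖ * (2 * ‖A₁ - A₂‖ * ‖f‖) := by
        refine mul_le_mul_of_nonneg_left ?_ (norm_nonneg _)
        exact (norm_Rstar_sub_apply_le h₁ h₂ _).trans
          (mul_le_mul_of_nonneg_left (norm_Qstar_apply_le f) (by positivity))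
    _ = _ := by ring

theorem norm_D_sub_le {L n : ℕ} (hL : 0 < L) {A₁ A₂ : Field n} (h₁ : ∀ x, ‖A₁ x‖ ≤ 1 / 2)
    (h₂ : ∀ x, ‖A₂ x‖ ≤ 1 / 2) : ‖D L A₁ - D L A₂‖ ≤ 2 * ‖G L n‖ * ‖A₁ - A₂‖ :=
  ContinuousLinearMap.opNorm_le_bound _ (by positivity) fun f => norm_D_sub_apply_le hL h₁ h₂ f

theorem isUnit_and_norm_inverse_le {E : Type*} [NormedAddCommGroup E] [NormedSpace ℝ E]
    [FiniteDimensional ℝ E] (T : E →L[ℝ] E) {C : ℝ} (hC : 0 ≤ C) (h : ∀ f, ‖f‖ ≤ C * ‖T f‖) :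
    IsUnit T ∧ ‖Ring.inverse T‖ ≤ C := by
  have hinj : Function.Injective T := by
    rw [injective_iff_map_eq_zero]
    intro f hf
    have := h f
    rw [hf, norm_zero, mul_zero] at this
    exact norm_le_zero_iff.1 this
  have hu : IsUnit T := by
    have := FiniteDimensional.complete ℝ E
    rw [ContinuousLinearMap.isUnit_iff_bijective]
    exact ⟨hinj, (LinearMap.injective_iff_surjective (f := T.toLinearMap)).1 hinj⟩
  refine ⟨hu, ContinuousLinearMap.opNorm_le_bound _ hC fun g => ?_⟩
  have e : T (Ring.inverse T g) = g :=
    congrArg (fun S : E →L[ℝ] E => S g) (Ring.mul_inverse_cancel _ hu)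
  have := h (Ring.inverse T g)
  rwa [e] at this

theorem norm_le_D_apply {L n : ℕ} (hL : 0 < L) {C₀ CG ε : ℝ} (hC₀ : 0 < C₀)
    (h₀ : ∀ f : CoarseField L n, ‖f‖ ≤ C₀ * ‖Q L n (G L n (Qstar L n f))‖) (hG : ‖G L n‖ ≤ CG)
    (hε0 : 0 ≤ ε) (hε : ε ≤ 1 / 2) (hsmall : 4 * (C₀ * CG) * ε ≤ 1) {A : Field n}
    (hA : A ∈ vecConf n ε) (f : CoarseField L n) : ‖f‖ ≤ 2 * C₀ * ‖D L A f‖ := by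
  have hA' : ‖A‖ ≤ ε := (pi_norm_le_iff_of_nonneg hε0).2 hA
  have hD0 : D L (0 : Field n) f = Q L n (G L n (Qstar L n f)) :=
    congrArg (fun v => Q L n (G L n v)) (Rstar_zero_apply _)
  have h1 := h₀ f
  rw [← hD0] at h1
  have h2 := norm_D_sub_apply_le hL (A₁ := (0 : Field n)) (A₂ := A) (fun x => by simp)
    (fun x => (hA x).trans hε) f
  rw [zero_sub, norm_neg] at h2
  have hCG : 0 ≤ CG := (norm_nonneg _).trans hG
  have h3 : 2 * ‖G L n‖ * ‖A‖ * ‖f‖ ≤ 2 * CG * ε * ‖f‖ := by gcongr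
  have h4 := norm_add_le (D L (0 : Field n) f - D L A f) (D L A f)
  rw [sub_add_cancel] at h4
  -- By `hsmall`, the perturbation contributes at most `‖f‖ / 2`, which is absorbed on the left and
  -- doubles `C₀`.
  have h5 : C₀ * ‖D L (0 : Field n) f‖ ≤ C₀ * (2 * CG * ε * ‖f‖ + ‖D L A f‖) :=
    mul_le_mul_of_nonneg_left (by linarith) hC₀.le
  have h6 := mul_le_mul_of_nonneg_right hsmall (norm_nonneg f)
  linarith

end NLSM
end

theorem mainTheorem8 (L : ℕ) (hL : 1 < L) (hodd : Odd L) :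
    ∃ ε₀ : ℝ, 0 < ε₀ ∧ ε₀ ≤ 1 ∧ ∃ C : ℝ, 0 < C ∧
      ∀ n : ℕ, 1 ≤ n → ∀ ε : ℝ, 0 < ε → ε ≤ ε₀ →
        (∀ A ∈ NLSM.vecConf n ε,
          IsUnit (NLSM.D L A) ∧ ‖Ring.inverse (NLSM.D L A)‖ ≤ C) ∧
        (∀ A₁ ∈ NLSM.vecConf n ε, ∀ A₂ ∈ NLSM.vecConf n ε,
          ‖Ring.inverse (NLSM.D L A₁) - Ring.inverse (NLSM.D L A₂)‖ ≤
              2 * ‖NLSM.G L n‖ * ‖Ring.inverse (NLSM.D L A₁)‖ * ‖Ring.inverse (NLSM.D L A₂)‖ *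
                ‖A₁ - A₂‖ ∧
          ‖Ring.inverse (NLSM.D L A₁) - Ring.inverse (NLSM.D L A₂)‖ ≤ C * ‖A₁ - A₂‖) := by
  have hL0 : 0 < L := by omega
  obtain ⟨CG, hCG, hG⟩ := NLSM.exists_norm_G_le hL0
  obtain ⟨C₀, hC₀, h₀⟩ := NLSM.exists_norm_le_QGQstar hL0
  -- The first entry gives the Lipschitz bound for `R*`, the second the absorption of the
  -- perturbation. The constant `C` adds the bounds for the two assertions.
  refine ⟨min (1 / 2) (1 / (4 * (C₀ * CG))), by positivity,
    (min_le_left _ _).trans (by norm_num), 2 * C₀ + 2 * CG * (2 * C₀) * (2 * C₀), by positivity,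
    fun n _ ε hε0 hε => ?_⟩
  have hε1 : ε ≤ 1 / 2 := hε.trans (min_le_left _ _)
  have hsmall : 4 * (C₀ * CG) * ε ≤ 1 := by
    have := hε.trans (min_le_right _ _)
    rwa [le_div_iff₀ (by positivity), mul_comm] at this
  have key : ∀ A ∈ NLSM.vecConf n ε,
      IsUnit (NLSM.D L A) ∧ ‖Ring.inverse (NLSM.D L A)‖ ≤ 2 * C₀ := fun A hA =>
    NLSM.isUnit_and_norm_inverse_le _ (by positivity)
      (NLSM.norm_le_D_apply hL0 hC₀ (h₀ n) (hG n) hε0.le hε1 hsmall hA)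
  refine ⟨fun A hA => ⟨(key A hA).1, (key A hA).2.trans (le_add_of_nonneg_right (by positivity))⟩,
    fun A₁ h₁ A₂ h₂ => ?_⟩
  obtain ⟨u₁, b₁⟩ := key A₁ h₁
  obtain ⟨u₂, b₂⟩ := key A₂ h₂
  have hlip : ‖Ring.inverse (NLSM.D L A₁) - Ring.inverse (NLSM.D L A₂)‖ ≤
      2 * ‖NLSM.G L n‖ * ‖Ring.inverse (NLSM.D L A₁)‖ * ‖Ring.inverse (NLSM.D L A₂)‖ *
        ‖A₁ - A₂‖ := by
    -- Resolvent identity.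
    have e : Ring.inverse (NLSM.D L A₁) - Ring.inverse (NLSM.D L A₂) =
        Ring.inverse (NLSM.D L A₁) * (NLSM.D L A₂ - NLSM.D L A₁) * Ring.inverse (NLSM.D L A₂) := by
      rw [mul_sub, sub_mul, mul_assoc, Ring.mul_inverse_cancel _ u₂, mul_one,
        Ring.inverse_mul_cancel _ u₁, one_mul]
    have hd := NLSM.norm_D_sub_le hL0 (fun x => (h₂ x).trans hε1) (fun x => (h₁ x).trans hε1)
    rw [norm_sub_rev A₂] at hd
    rw [e]
    calc _ ≤ ‖Ring.inverse (NLSM.D L A₁)‖ * ‖NLSM.D L A₂ - NLSM.D L A₁‖ *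
          ‖Ring.inverse (NLSM.D L A₂)‖ :=
          (norm_mul_le _ _).trans (mul_le_mul_of_nonneg_right (norm_mul_le _ _) (norm_nonneg _))
      _ ≤ ‖Ring.inverse (NLSM.D L A₁)‖ * (2 * ‖NLSM.G L n‖ * ‖A₁ - A₂‖) *
          ‖Ring.inverse (NLSM.D L A₂)‖ := by gcongr
      _ = _ := by ring
  refine ⟨hlip, hlip.trans (mul_le_mul_of_nonneg_right ?_ (norm_nonneg _))⟩
  calc _ ≤ 2 * CG * (2 * C₀) * (2 * C₀) := by
        gcongr
        exact hG n
    _ ≤ _ := le_add_of_nonneg_left (by positivity)
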